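/- Let $M$ be a smooth manifold of dimension $d\ge 4$ with a smooth Lorentzian metric $g$ of signature $(-,+,\dots,+)$ and Levi-Civita connection $\nabla$. Let $F$ be a smooth Maxwell 2-form on $M$, i.e. $\nabla^\mu F_{\mu\nu}=0$ and $\nabla_{[\lambda}F_{\mu\nu]}=0$, and let $\ell$ be a smooth, nowhere zero, null vector field on $M$. A null frame containing $\ell$ at a point is a basis $e_{(0)}=\ell,\ e_{(1)}=n,\ e_{(i)}=m_{(i)}$ ($2\le i\le d-1$) of the tangent space whose only non-vanishing scalar products are $\ell\cdot n=1$ and $m_{(i)}\cdot m_{(j)}=\delta_{ij}$; frame components are denoted by indices $0,1,i$. Suppose that $\ell$ is multiply aligned with $F$: at every point, in a null frame containing $\ell$, the components of $F$ of non-negative boost weight vanish, i.e. $F_{0i}=0$, $F_{01}=0$ and $F_{ij}=0$. Put $L_{\mu\nu}=\nabla_\nu\ell_\mu$, and in a null frame containing $\ell$ let $\kappa_i=L_{i0}$, $\rho_{ij}=L_{ij}$, $\rho=\sum_i\rho_{ii}$ and $\varphi'_i=F_{1i}$ (the boost weight $-1$ part of $F$). Then at every point at which $F\neq 0$ the field $\ell$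 is geodesic, i.e. $\ell^\nu\nabla_\nu\ell^\mu$ is a multiple of $\ell^\mu$, and in every null frame containing $\ell$ at that point $\kappa_i=0$ for all $i$, and 1. the symmetric part $\rho_{(ij)}=\frac12(\rho_{ij}+\rho_{ji})$ has the eigenvalue $\rho/2$, with (nonzero) eigenvector $\varphi'_i$; 2. the antisymmetric part $\rho_{[ij]}=\frac12(\rho_{ij}-\rho_{ji})$ satisfies $\rho_{[ij]}=\varphi'_{[i}\omega_{j]}=\frac12(\varphi'_i\omega_j-\varphi'_j\omega_i)$ for some $\omega_i$. In particular, if $F$ vanishes nowhere, all of this holds on the whole of $M$. -/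

import Mathlib

open scoped Manifold ContDiff Matrix

/-! Lorentzian geometry of a smooth `d`-dimensional manifold, in charts. The signature is
`(-, +, ..., +)`. Quantities such as `∇ℓ` and `∇F` at a point `x` are computed by the classical
index formulas in the preferred chart `extChartAt (𝓡 d) x` around `x`; as these are tensors, the
choice of the chart is immaterial. -/

namespace Spacetime

noncomputable section

/-- A smooth Lorentzian metric on a smooth manifold of dimension `d`. -/
structure LorentzMetric (d : ℕ) (M : Type*) [TopologicalSpace M]
    [ChartedSpace (EuclideanSpace ℝ (Fin d)) M] [IsManifold (𝓡 d) ∞ M] where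
  /-- the scalar product `g_x(v, w)` on each tangent space -/
  val (x : M) : TangentSpace (𝓡 d) x →L[ℝ] TangentSpace (𝓡 d) x →L[ℝ] ℝ
  symm (x : M) (v w : TangentSpace (𝓡 d) x) : val x v w = val x w v
  /-- at each point there is an orthonormal basis with one timelike and `d - 1` spacelike vectors -/
  signature (x : M) : ∃ b : Module.Basis (Fin d) ℝ (TangentSpace (𝓡 d) x),
    ∀ i j, val x (b i) (b j) = if i = j then (if i.val = 0 then -1 else 1) else 0
  contMDiff : ContMDiff (𝓡 d) ((𝓡 d).prod 𝓘(ℝ, EuclideanSpace ℝ (Fin d) →L[ℝ]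
      EuclideanSpace ℝ (Fin d) →L[ℝ] ℝ)) ∞
    (fun x ↦ Bundle.TotalSpace.mk' (EuclideanSpace ℝ (Fin d) →L[ℝ]
      EuclideanSpace ℝ (Fin d) →L[ℝ] ℝ) x (val x))

/-- A smooth differential 2-form, as a field of alternating bilinear forms. -/
structure TwoForm (d : ℕ) (M : Type*) [TopologicalSpace M]
    [ChartedSpace (EuclideanSpace ℝ (Fin d)) M] [IsManifold (𝓡 d) ∞ M] where
  val (x : M) : TangentSpace (𝓡 d) x →L[ℝ] TangentSpace (𝓡 d) x →L[ℝ] ℝ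
  alt (x : M) (v : TangentSpace (𝓡 d) x) : val x v v = 0
  contMDiff : ContMDiff (𝓡 d) ((𝓡 d).prod 𝓘(ℝ, EuclideanSpace ℝ (Fin d) →L[ℝ]
      EuclideanSpace ℝ (Fin d) →L[ℝ] ℝ)) ∞
    (fun x ↦ Bundle.TotalSpace.mk' (EuclideanSpace ℝ (Fin d) →L[ℝ]
      EuclideanSpace ℝ (Fin d) →L[ℝ] ℝ) x (val x))

/-- A smooth vector field. -/
structure SmoothVectorField (d : ℕ) (M : Type*) [TopologicalSpace M]
    [ChartedSpace (EuclideanSpace ℝ (Fin d)) M] [IsManifold (𝓡 d) ∞ M] where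
  val (x : M) : TangentSpace (𝓡 d) x
  contMDiff : ContMDiff (𝓡 d) (𝓡 d).tangent ∞
    (fun x ↦ (⟨x, val x⟩ : TangentBundle (𝓡 d) M))

variable {d : ℕ} {M : Type*} [TopologicalSpace M]
  [ChartedSpace (EuclideanSpace ℝ (Fin d)) M] [IsManifold (𝓡 d) ∞ M]

/-! ### Components in the chart around a point `c`, as functions of the coordinates `y` -/

/-- The coordinate vector `∂_μ` of the chart around `c`, at the point with coordinates `y`. -/
def coordVec (c : M) (μ : Fin d) (y : EuclideanSpace ℝ (Fin d)) :
    TangentSpace (𝓡 d) ((extChartAt (𝓡 d) c).symm y) :=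
  mfderiv 𝓘(ℝ, EuclideanSpace ℝ (Fin d)) (𝓡 d) (extChartAt (𝓡 d) c).symm y
    (EuclideanSpace.single μ (1 : ℝ))

/-- The contravariant component `v^μ` of a tangent vector `v` at `x` in the chart around `x`. -/
def vecComp (x : M) (v : TangentSpace (𝓡 d) x) (μ : Fin d) : ℝ :=
  (EuclideanSpace.proj μ : EuclideanSpace ℝ (Fin d) →L[ℝ] ℝ)
    (mfderiv (𝓡 d) 𝓘(ℝ, EuclideanSpace ℝ (Fin d)) (extChartAt (𝓡 d) x) x v)

/-- The partial derivative `∂_μ f` of a function of the coordinates. -/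
def partialDeriv (μ : Fin d) (f : EuclideanSpace ℝ (Fin d) → ℝ)
    (y : EuclideanSpace ℝ (Fin d)) : ℝ :=
  fderiv ℝ f y (EuclideanSpace.single μ (1 : ℝ))

/-- The metric components `g_{μν}`. -/
def metricComp (g : LorentzMetric d M) (c : M) (y : EuclideanSpace ℝ (Fin d)) :
    Matrix (Fin d) (Fin d) ℝ :=
  Matrix.of fun μ ν ↦ g.val ((extChartAt (𝓡 d) c).symm y) (coordVec c μ y) (coordVec c ν y)

/-- The Christoffel symbols
`Γ^σ_{μν} = (1/2) g^{σλ} (∂_μ g_{λν} + ∂_ν g_{λμ} - ∂_λ g_{μν})` of the Levi-Civita connection. -/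
def christoffel (g : LorentzMetric d M) (c : M) (y : EuclideanSpace ℝ (Fin d))
    (σ μ ν : Fin d) : ℝ :=
  (1 / 2) * ∑ l, (metricComp g c y)⁻¹ σ l *
    (partialDeriv μ (fun z ↦ metricComp g c z l ν) y
      + partialDeriv ν (fun z ↦ metricComp g c z l μ) y
      - partialDeriv l (fun z ↦ metricComp g c z μ ν) y)

/-- The covariant components `X_μ = g_{μν} X^ν` of a vector field `X`. -/
def lowerComp (g : LorentzMetric d M) (X : SmoothVectorField d M) (c : M)
    (y : EuclideanSpace ℝ (Fin d)) (μ : Fin d) : ℝ :=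
  g.val ((extChartAt (𝓡 d) c).symm y) (X.val ((extChartAt (𝓡 d) c).symm y)) (coordVec c μ y)

/-- `∇_ν X_μ = ∂_ν X_μ - Γ^σ_{νμ} X_σ`; the index of differentiation comes first. -/
def covDerivVec (g : LorentzMetric d M) (X : SmoothVectorField d M) (c : M)
    (y : EuclideanSpace ℝ (Fin d)) (ν μ : Fin d) : ℝ :=
  partialDeriv ν (fun z ↦ lowerComp g X c z μ) y
    - ∑ σ, christoffel g c y σ ν μ * lowerComp g X c y σ

/-- The components `F_{μν}` of a 2-form. -/
def formComp (F : TwoForm d M) (c : M) (y : EuclideanSpace ℝ (Fin d)) (μ ν : Fin d) : ℝ :=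
  F.val ((extChartAt (𝓡 d) c).symm y) (coordVec c μ y) (coordVec c ν y)

/-- `∇_l F_{μν} = ∂_l F_{μν} - Γ^σ_{lμ} F_{σν} - Γ^σ_{lν} F_{μσ}`; the index of differentiation
comes first. -/
def covDerivForm (g : LorentzMetric d M) (F : TwoForm d M) (c : M)
    (y : EuclideanSpace ℝ (Fin d)) (l μ ν : Fin d) : ℝ :=
  partialDeriv l (fun z ↦ formComp F c z μ ν) y
    - ∑ σ, christoffel g c y σ l μ * formComp F c y σ ν
    - ∑ σ, christoffel g c y σ l ν * formComp F c y μ σ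

/-! ### Maxwell fields -/

/-- The source-free Maxwell equations `∇^μ F_{μν} = 0` and `∇_{[l} F_{μν]} = 0` at every point (the
second is written as a cyclic sum, since `F` is antisymmetric). -/
def IsMaxwell (g : LorentzMetric d M) (F : TwoForm d M) : Prop :=
  ∀ x : M,
    (∀ ν, ∑ l, ∑ μ, (metricComp g x (extChartAt (𝓡 d) x x))⁻¹ l μ *
      covDerivForm g F x (extChartAt (𝓡 d) x x) l μ ν = 0) ∧
    (∀ l μ ν, covDerivForm g F x (extChartAt (𝓡 d) x x) l μ ν
      + covDerivForm g F x (extChartAt (𝓡 d) x x) μ ν l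
      + covDerivForm g F x (extChartAt (𝓡 d) x x) ν l μ = 0)

/-! ### Null frames and the optical matrix -/

/-- The scalar `w^μ v^ν ∇_ν X_μ = g(w, ∇_v X)` at `x`. -/
def nablaAt (g : LorentzMetric d M) (X : SmoothVectorField d M) (x : M)
    (w v : TangentSpace (𝓡 d) x) : ℝ :=
  ∑ μ, ∑ ν, vecComp x w μ * vecComp x v ν * covDerivVec g X x (extChartAt (𝓡 d) x x) ν μ

/-- `ℓ` is a null vector field: everywhere null and nonzero. -/
def IsNullField (g : LorentzMetric d M) (ℓ : SmoothVectorField d M) : Prop :=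
  ∀ x, ℓ.val x ≠ 0 ∧ g.val x (ℓ.val x) (ℓ.val x) = 0

/-- A null frame `{l, n, m_i}` of the tangent space at `x` whose first vector is `l`. The spatial
indices `2, ..., d - 1` are represented by `Fin (d - 2)`. -/
structure NullFrame (g : LorentzMetric d M) (x : M) (l : TangentSpace (𝓡 d) x) where
  n : TangentSpace (𝓡 d) x
  m : Fin (d - 2) → TangentSpace (𝓡 d) x
  l_l : g.val x l l = 0
  n_n : g.val x n n = 0
  l_n : g.val x l n = 1
  l_m : ∀ i, g.val x l (m i) = 0
  n_m : ∀ i, g.val x n (m i) = 0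
  m_m : ∀ i j, g.val x (m i) (m j) = if i = j then 1 else 0

/-- `ℓ` is multiply aligned with `F`: at every point, in a null frame containing `ℓ`, the components
`F_{0i}` (boost weight 1) and `F_{01}`, `F_{ij}` (boost weight 0) vanish. -/
def MultiplyAligned (g : LorentzMetric d M) (F : TwoForm d M) (ℓ : SmoothVectorField d M) : Prop :=
  ∀ x, ∃ e : NullFrame g x (ℓ.val x),
    (∀ i, F.val x (ℓ.val x) (e.m i) = 0) ∧
    F.val x (ℓ.val x) e.n = 0 ∧
    ∀ i j, F.val x (e.m i) (e.m j) = 0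

/-- `ℓ` is geodesic at `x`: `ℓ^ν ∇_ν ℓ^μ` is a multiple of `ℓ^μ` there. -/
def GeodesicAt (g : LorentzMetric d M) (ℓ : SmoothVectorField d M) (x : M) : Prop :=
  ∃ a : ℝ, ∀ w, nablaAt g ℓ x w (ℓ.val x) = a * g.val x w (ℓ.val x)

/-- `κ_i = L_{i0}`, where `L_{μν} = ∇_ν ℓ_μ`. -/
def kappa {g : LorentzMetric d M} {ℓ : SmoothVectorField d M} {x : M}
    (e : NullFrame g x (ℓ.val x)) (i : Fin (d - 2)) : ℝ :=
  nablaAt g ℓ x (e.m i) (ℓ.val x)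

/-- The optical matrix `ρ_{ij} = L_{ij}`, where `L_{μν} = ∇_ν ℓ_μ`. -/
def rho {g : LorentzMetric d M} {ℓ : SmoothVectorField d M} {x : M}
    (e : NullFrame g x (ℓ.val x)) : Matrix (Fin (d - 2)) (Fin (d - 2)) ℝ :=
  Matrix.of fun i j ↦ nablaAt g ℓ x (e.m i) (e.m j)

/-- The boost weight `-1` component `φ'_i = F_{1i}` of a 2-form. -/
def phiPrime (F : TwoForm d M) {g : LorentzMetric d M} {x : M} {l : TangentSpace (𝓡 d) x}
    (e : NullFrame g x l) (i : Fin (d - 2)) : ℝ :=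
  F.val x e.n (e.m i)

/-- The symmetric part `A_{(ij)} = (A_{ij} + A_{ji}) / 2` of a matrix. -/
def symPart {k : ℕ} (A : Matrix (Fin k) (Fin k) ℝ) : Matrix (Fin k) (Fin k) ℝ :=
  (1 / 2 : ℝ) • (A + Aᵀ)

/-- The antisymmetric part `A_{[ij]} = (A_{ij} - A_{ji}) / 2` of a matrix. -/
def antisymPart {k : ℕ} (A : Matrix (Fin k) (Fin k) ℝ) : Matrix (Fin k) (Fin k) ℝ :=
  (1 / 2 : ℝ) • (A - Aᵀ)

end

end Spacetime

open Spacetime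

/-! Write `ℓ♭` for the 1-form `g(ℓ, ·)`. Alignment says that `F = ℓ♭ ∧ φ` at each point, hence `F(·,
ℓ) = 0` and `F ∧ ℓ♭ = 0` everywhere. These two identities mention no frame other than `ℓ`, so they
can be differentiated without extending a null frame smoothly.

Differentiating the first gives `(∇_a F)(b, ℓ) = -F(b, ∇_a ℓ)`; since `ℓ` is null, `∇_a ℓ` has no
`n` component, so only its `m_i` components contribute (`nablaFormAt_apply_null`). Differentiating
the second (`nablaFormAt_wedge`) and inserting `n, m_i, m_j` gives `(∇_a F)(m_i, m_j) = φ'_j L(m_i,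
a) - φ'_i L(m_j, a)`. The Maxwell equations then become algebraic in `φ'` and `L`
(`maxwell_frame_equations`):

the divergence along `ℓ` gives `φ' · κ = 0`, and the cyclic identity on `ℓ, m_i, m_j` gives `φ' ∧ κ
= 0`, so `κ = 0` because `φ' ≠ 0`;

the divergence along `m_j` and the cyclic identity on `ℓ, n, m_j` share the unknown `(∇_ℓ F)(n,
m_j)`, and eliminating it gives the eigenvector equation;

the cyclic identity on `m_i, m_j, m_q` gives `φ'_{[i} ρ_{jq]} = 0`, and contracting it with `φ'`
exhibits `ω`. -/

namespace Spacetime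

/-! ### Coordinate vector fields as a smooth local frame of the tangent bundle. -/

section ChartFrame

open Bundle Filter Topology

theorem differentiableAt_chart_of_contMDiffAt {d : ℕ} {M : Type*} [TopologicalSpace M]
    [ChartedSpace (EuclideanSpace ℝ (Fin d)) M] {x : M} {f : M → ℝ}
    (hf : ContMDiffAt (𝓡 d) 𝓘(ℝ, ℝ) ∞ f x) :
    DifferentiableAt ℝ (fun y ↦ f ((extChartAt (𝓡 d) x).symm y)) (extChartAt (𝓡 d) x x) := by
  have h := (contMDiffAt_iff.1 hf).2
  simp only [ModelWithCorners.range_eq_univ, contDiffWithinAt_univ] at h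
  exact h.differentiableAt (by simp)

variable {d : ℕ} {M : Type*} [TopologicalSpace M]
  [ChartedSpace (EuclideanSpace ℝ (Fin d)) M] [IsManifold (𝓡 d) ∞ M]

instance : IsManifold (𝓡 d) 1 M := IsManifold.of_le (n := ∞) (by simp)

/-- The coordinate vector fields of the chart around `c`, as a local frame on `M`. -/
noncomputable def chartFrame (c : M) (μ : Fin d) (p : M) : TangentSpace (𝓡 d) p :=
  (trivializationAt (EuclideanSpace ℝ (Fin d)) (TangentSpace (𝓡 d)) c).localFrame
    (EuclideanSpace.basisFun (Fin d) ℝ).toBasis μ p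

/-- The components of a tangent vector in the frame `chartFrame c`. -/
noncomputable def chartCoeff (c : M) (μ : Fin d) (p : M) : TangentSpace (𝓡 d) p →ₗ[ℝ] ℝ :=
  (trivializationAt (EuclideanSpace ℝ (Fin d)) (TangentSpace (𝓡 d)) c).localFrameCoeff (𝓡 d)
    (EuclideanSpace.basisFun (Fin d) ℝ).toBasis μ p

theorem eq_sum_chartCoeff_smul {c p : M} (hp : p ∈ (chartAt (EuclideanSpace ℝ (Fin d)) c).source)
    (v : TangentSpace (𝓡 d) p) : v = ∑ μ, chartCoeff c μ p v • chartFrame c μ p := by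
  classical
  -- The frame expansion is stated for sections, so `v` is extended by zero away from `p`; no
  -- regularity of the section is involved.
  have := (trivializationAt (EuclideanSpace ℝ (Fin d))
    (TangentSpace (𝓡 d) (M := M)) c).eq_sum_localFrameCoeff_smul (I := 𝓡 d) (x' := p)
    (b := (EuclideanSpace.basisFun (Fin d) ℝ).toBasis)
    (s := fun q ↦ if h : q = p then h ▸ v else 0) (by simpa using hp)
  simpa using! this

/-- The inverse of the trivialization at `c` is the derivative of the inverse chart. This carries
bundle smoothness over to the coordinate formulas, but only inside the chart target; later
identities are therefore differentiated after restriction to a neighbourhood. -/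
theorem coordVec_eq_chartFrame {c : M} {y : EuclideanSpace ℝ (Fin d)}
    (hy : y ∈ (extChartAt (𝓡 d) c).target) (μ : Fin d) :
    coordVec c μ y = chartFrame c μ ((extChartAt (𝓡 d) c).symm y) := by
  have hp : (extChartAt (𝓡 d) c).symm y ∈ (chartAt (EuclideanSpace ℝ (Fin d)) c).source := by
    simpa using (extChartAt (𝓡 d) c).map_target hy
  have h := TangentBundle.symmL_trivializationAt (I := 𝓡 d) hp
  rw [(extChartAt (𝓡 d) c).right_inv hy, ModelWithCorners.range_eq_univ,
    mfderivWithin_univ] at h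
  have hb : (extChartAt (𝓡 d) c).symm y ∈ (trivializationAt (EuclideanSpace ℝ (Fin d))
    (TangentSpace (𝓡 d)) c).baseSet := by simpa using hp
  have hf : chartFrame c μ ((extChartAt (𝓡 d) c).symm y) =
      (trivializationAt (EuclideanSpace ℝ (Fin d)) (TangentSpace (𝓡 d)) c).symmL ℝ
        ((extChartAt (𝓡 d) c).symm y) (EuclideanSpace.single μ (1 : ℝ)) := by
    rw [chartFrame, Trivialization.localFrame_apply_of_mem_baseSet (hx := hb),
      Trivialization.symmL_apply _ hb]
    unfold Trivialization.basisAt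
    rw [Module.Basis.map_apply, OrthonormalBasis.coe_toBasis, EuclideanSpace.basisFun_apply]
    rfl
  rw [hf]
  exact (DFunLike.congr_fun h (EuclideanSpace.single μ (1 : ℝ))).symm

theorem vecComp_eq_chartCoeff (x : M) (v : TangentSpace (𝓡 d) x) (μ : Fin d) :
    vecComp x v μ = chartCoeff x μ x v := by
  classical
  have hx := mem_chart_source (EuclideanSpace ℝ (Fin d)) x
  have h := TangentBundle.continuousLinearMapAt_trivializationAt (I := 𝓡 d) hx
  have := (trivializationAt (EuclideanSpace ℝ (Fin d))
    (TangentSpace (𝓡 d) (M := M)) x).localFrameCoeff_eq_coeff (I := 𝓡 d) (x := x) (i := μ)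
    (b := (EuclideanSpace.basisFun (Fin d) ℝ).toBasis)
    (s := fun q ↦ if h : q = x then h ▸ v else 0) (by simp)
  simp only [dite_true] at this
  rw [chartCoeff, this]
  have hv : (trivializationAt (EuclideanSpace ℝ (Fin d)) (TangentSpace (𝓡 d)) x).continuousLinearMapAt
      ℝ x v = (trivializationAt (EuclideanSpace ℝ (Fin d)) (TangentSpace (𝓡 d)) x ⟨x, v⟩).2 := by
    rw [Trivialization.continuousLinearMapAt_apply,
      Trivialization.coe_linearMapAt_of_mem _ (by simp)]
  rw [← hv]
  exact congrArg (fun w : EuclideanSpace ℝ (Fin d) ↦ w μ) (DFunLike.congr_fun h v).symm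

theorem contMDiffAt_chartFrame (x : M) (μ : Fin d) :
    ContMDiffAt (𝓡 d) (𝓡 d).tangent ∞
      (fun p ↦ (⟨p, chartFrame x μ p⟩ : TangentBundle (𝓡 d) M)) x :=
  contMDiffAt_localFrame_of_mem ∞ _ _ μ (by simp)

theorem contMDiffAt_apply_chartFrame
    {B : ∀ p : M, TangentSpace (𝓡 d) p →L[ℝ] TangentSpace (𝓡 d) p →L[ℝ] ℝ}
    (hB : ContMDiff (𝓡 d) ((𝓡 d).prod 𝓘(ℝ, EuclideanSpace ℝ (Fin d) →L[ℝ]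
        EuclideanSpace ℝ (Fin d) →L[ℝ] ℝ)) ∞
      (fun x ↦ Bundle.TotalSpace.mk' (EuclideanSpace ℝ (Fin d) →L[ℝ]
        EuclideanSpace ℝ (Fin d) →L[ℝ] ℝ) x (B x))) (x : M) (μ ν : Fin d) :
    ContMDiffAt (𝓡 d) 𝓘(ℝ, ℝ) ∞ (fun p ↦ B p (chartFrame x μ p) (chartFrame x ν p)) x := by
  have := ContMDiffAt.clm_bundle_apply₂ (F₃ := ℝ) (E₃ := fun _ : M ↦ ℝ) (hB x)
    (contMDiffAt_chartFrame x μ) (contMDiffAt_chartFrame x ν)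
  simpa [contMDiffAt_section] using this

theorem contMDiffAt_chartCoeff (X : SmoothVectorField d M) (x : M) (μ : Fin d) :
    ContMDiffAt (𝓡 d) 𝓘(ℝ, ℝ) ∞ (fun p ↦ chartCoeff x μ p (X.val p)) x :=
  contMDiffAt_localFrameCoeff (I := 𝓡 d) _ (by simp) (X.contMDiff x) μ

end ChartFrame
-- Covariant differentiation as index algebra, with partial derivatives as free symbols.
section CoordinateAlgebra

variable {ι : Type*} [Fintype ι]

/-- Lowering the upper index of a Christoffel symbol cancels the inverse metric and leaves the
symbol of the first kind; `K` stands for the bracket of metric derivatives. -/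
theorem sum_mul_christoffel [DecidableEq ι] {G H : Matrix ι ι ℝ} (hGH : G * H = 1)
    (K : ι → ℝ) (μ : ι) :
    ∑ σ, G μ σ * ((1 / 2) * ∑ l, H σ l * K l) = (1 / 2) * K μ := by
  have h : (G * H) *ᵥ K = K := by rw [hGH, Matrix.one_mulVec]
  have h' := congrFun h μ
  rw [← Matrix.mulVec_mulVec] at h'
  simp only [Matrix.mulVec, dotProduct] at h'
  rw [← h', Finset.mul_sum]
  exact Finset.sum_congr rfl fun σ _ ↦ by ring

/-- `g_{μσ} ∇_λ u^σ = ∇_λ u_μ`. -/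
theorem lower_covDeriv {G : ι → ι → ℝ} {dG Γ : ι → ι → ι → ℝ} {u l : ι → ℝ} {du dl : ι → ι → ℝ}
    (hG : ∀ μ ν, G μ ν = G ν μ) (hdG : ∀ a μ ν, dG a μ ν = dG a ν μ)
    (hΓ : ∀ μ a ν, ∑ σ, G μ σ * Γ σ a ν = (1 / 2) * (dG a μ ν + dG ν μ a - dG μ a ν))
    (hl : ∀ μ, l μ = ∑ ν, G μ ν * u ν)
    (hdl : ∀ a μ, dl a μ = ∑ ν, (dG a μ ν * u ν + G μ ν * du a ν)) (a μ : ι) :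
    ∑ σ, G μ σ * (du a σ + ∑ ν, Γ σ a ν * u ν) = dl a μ - ∑ σ, Γ σ a μ * l σ := by
  have h1 : ∑ σ, G μ σ * ∑ ν, Γ σ a ν * u ν
      = ∑ ν, (1 / 2) * (dG a μ ν + dG ν μ a - dG μ a ν) * u ν := by
    simp only [← hΓ, Finset.mul_sum, Finset.sum_mul]
    rw [Finset.sum_comm]
    simp only [mul_assoc]
  have h2 : ∑ σ, Γ σ a μ * l σ
      = ∑ ν, (1 / 2) * (dG a ν μ + dG μ ν a - dG ν a μ) * u ν := by
    simp only [← hΓ, hl, Finset.mul_sum, Finset.sum_mul]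
    rw [Finset.sum_comm]
    refine Finset.sum_congr rfl fun ν _ ↦ Finset.sum_congr rfl fun σ _ ↦ ?_
    rw [hG ν σ]; ring
  simp only [mul_add, Finset.sum_add_distrib]
  rw [h1, h2, hdl, ← Finset.sum_add_distrib, ← Finset.sum_sub_distrib]
  refine Finset.sum_congr rfl fun ν _ ↦ ?_
  rw [hdG a ν μ, hdG μ ν a, hdG ν a μ]; ring

/-- `u^μ ∇_a u_μ = 0` for a null field. -/
theorem sum_mul_covDeriv_eq_zero {G : ι → ι → ℝ} {Γ : ι → ι → ι → ℝ} {u l : ι → ℝ}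
    {du dl : ι → ι → ℝ} (hG : ∀ μ ν, G μ ν = G ν μ)
    (hl : ∀ μ, l μ = ∑ ν, G μ ν * u ν) (a : ι)
    (hlow : ∀ μ, ∑ σ, G μ σ * (du a σ + ∑ ν, Γ σ a ν * u ν) = dl a μ - ∑ σ, Γ σ a μ * l σ)
    (hnull : ∑ μ, (du a μ * l μ + u μ * dl a μ) = 0) :
    ∑ μ, u μ * (dl a μ - ∑ σ, Γ σ a μ * l σ) = 0 := by
  have h1 : ∑ μ, u μ * (dl a μ - ∑ σ, Γ σ a μ * l σ)
      = ∑ σ, l σ * (du a σ + ∑ ν, Γ σ a ν * u ν) := by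
    simp only [← hlow]
    simp only [hl, Finset.sum_mul]
    simp only [Finset.mul_sum]
    rw [Finset.sum_comm]
    refine Finset.sum_congr rfl fun ν _ ↦ Finset.sum_congr rfl fun σ _ ↦ ?_
    rw [hG ν σ, ← mul_assoc, mul_comm (u σ)]
  have h2 : ∑ σ, l σ * (du a σ + ∑ ν, Γ σ a ν * u ν)
      = ∑ σ, du a σ * l σ + ∑ μ, u μ * ∑ σ, Γ σ a μ * l σ := by
    simp only [mul_add, Finset.sum_add_distrib, Finset.mul_sum]
    congr 1
    · exact Finset.sum_congr rfl fun _ _ ↦ mul_comm _ _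
    · rw [Finset.sum_comm]
      exact Finset.sum_congr rfl fun _ _ ↦ Finset.sum_congr rfl fun _ _ ↦ by ring
  have h3 := h1.trans h2
  simp only [mul_sub, Finset.sum_sub_distrib, Finset.sum_add_distrib] at h1 h3 hnull ⊢
  linarith

/-- The covariant derivative of `F_{μν} u^ν = 0`. -/
theorem sum_covDerivForm_mul {Γ : ι → ι → ι → ℝ} {u : ι → ℝ} {du f : ι → ι → ℝ}
    {df : ι → ι → ι → ℝ} (hf : ∀ μ, ∑ ν, f μ ν * u ν = 0) (a μ : ι)
    (hdf : ∑ ν, (df a μ ν * u ν + f μ ν * du a ν) = 0) :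
    ∑ ν, (df a μ ν - ∑ σ, Γ σ a μ * f σ ν - ∑ σ, Γ σ a ν * f μ σ) * u ν
      = - ∑ σ, f μ σ * (du a σ + ∑ ν, Γ σ a ν * u ν) := by
  have h1 : ∑ ν, (∑ σ, Γ σ a μ * f σ ν) * u ν = 0 := by
    simp only [Finset.sum_mul]
    rw [Finset.sum_comm]
    simp only [mul_assoc, ← Finset.mul_sum, hf, mul_zero, Finset.sum_const_zero]
  have h2 : ∑ ν, (∑ σ, Γ σ a ν * f μ σ) * u ν = ∑ σ, f μ σ * ∑ ν, Γ σ a ν * u ν := by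
    simp only [Finset.sum_mul, Finset.mul_sum]
    rw [Finset.sum_comm]
    exact Finset.sum_congr rfl fun _ _ ↦ Finset.sum_congr rfl fun _ _ ↦ by ring
  simp only [sub_mul, mul_add, Finset.sum_sub_distrib, Finset.sum_add_distrib] at hdf ⊢
  linarith

/-- The covariant derivative of `F_{[μν} l_{λ]} = 0`. -/
theorem covDeriv_wedge {Γ : ι → ι → ι → ℝ} {l : ι → ℝ} {dl f : ι → ι → ℝ}
    {df : ι → ι → ι → ℝ}
    (hfl : ∀ μ ν b, f μ ν * l b + f ν b * l μ + f b μ * l ν = 0) (a μ ν b : ι)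
    (hdfl : (df a μ ν * l b + f μ ν * dl a b) + (df a ν b * l μ + f ν b * dl a μ)
      + (df a b μ * l ν + f b μ * dl a ν) = 0) :
    ((df a μ ν - ∑ σ, Γ σ a μ * f σ ν - ∑ σ, Γ σ a ν * f μ σ) * l b
        + f μ ν * (dl a b - ∑ σ, Γ σ a b * l σ))
      + ((df a ν b - ∑ σ, Γ σ a ν * f σ b - ∑ σ, Γ σ a b * f ν σ) * l μ
        + f ν b * (dl a μ - ∑ σ, Γ σ a μ * l σ))
      + ((df a b μ - ∑ σ, Γ σ a b * f σ μ - ∑ σ, Γ σ a μ * f b σ) * l ν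
        + f b μ * (dl a ν - ∑ σ, Γ σ a ν * l σ)) = 0 := by
  -- The connection terms acting on one fixed slot are the undifferentiated identity with that slot
  -- replaced by `σ`, so they vanish for each slot separately.
  have key : ∀ μ ν b, (∑ σ, Γ σ a μ * f σ ν) * l b + f ν b * ∑ σ, Γ σ a μ * l σ
      + (∑ σ, Γ σ a μ * f b σ) * l ν = 0 := by
    intro μ ν b
    simp only [Finset.sum_mul, Finset.mul_sum, ← Finset.sum_add_distrib]
    refine Finset.sum_eq_zero fun σ _ ↦ ?_
    linear_combination Γ σ a μ * hfl σ ν b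
  linear_combination hdfl - key μ ν b - key ν b μ - key b μ ν

end CoordinateAlgebra

/-! ### Rules for partial derivatives. -/

section PartialDeriv

open Filter Topology

variable {d : ℕ} {y : EuclideanSpace ℝ (Fin d)}

theorem partialDeriv_congr {f h : EuclideanSpace ℝ (Fin d) → ℝ} (a : Fin d) (hfh : f =ᶠ[𝓝 y] h) :
    partialDeriv a f y = partialDeriv a h y := by
  rw [partialDeriv, hfh.fderiv_eq, partialDeriv]

theorem partialDeriv_const (a : Fin d) (c : ℝ) : partialDeriv a (fun _ ↦ c) y = 0 := by
  simp [partialDeriv]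

theorem partialDeriv_add {f h : EuclideanSpace ℝ (Fin d) → ℝ} (a : Fin d)
    (hf : DifferentiableAt ℝ f y) (hh : DifferentiableAt ℝ h y) :
    partialDeriv a (fun z ↦ f z + h z) y = partialDeriv a f y + partialDeriv a h y := by
  simp [partialDeriv, fderiv_fun_add hf hh]

theorem partialDeriv_mul {f h : EuclideanSpace ℝ (Fin d) → ℝ} (a : Fin d)
    (hf : DifferentiableAt ℝ f y) (hh : DifferentiableAt ℝ h y) :
    partialDeriv a (fun z ↦ f z * h z) y = partialDeriv a f y * h y + f y * partialDeriv a h y := by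
  simp [partialDeriv, fderiv_fun_mul hf hh]; ring

theorem partialDeriv_sum_mul {ι : Type*} [Fintype ι] {f h : ι → EuclideanSpace ℝ (Fin d) → ℝ}
    (a : Fin d) (hf : ∀ i, DifferentiableAt ℝ (f i) y) (hh : ∀ i, DifferentiableAt ℝ (h i) y) :
    partialDeriv a (fun z ↦ ∑ i, f i z * h i z) y
      = ∑ i, (partialDeriv a (f i) y * h i y + f i y * partialDeriv a (h i) y) := by
  simp only [← partialDeriv_mul a (hf _) (hh _)]
  unfold partialDeriv
  rw [fderiv_fun_sum (A := fun i z ↦ f i z * h i z) fun i _ ↦ (hf i).mul (hh i)]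
  simp

end PartialDeriv
-- Chart components of the fields and the differentiated identities.
section ChartComponents

open Filter Topology

variable {d : ℕ} {M : Type*} [TopologicalSpace M]
  [ChartedSpace (EuclideanSpace ℝ (Fin d)) M] [IsManifold (𝓡 d) ∞ M]

theorem chartCoeff_chartFrame (x : M) (μ ν : Fin d) :
    chartCoeff x ν x (chartFrame x μ x) = if μ = ν then 1 else 0 := by
  have hb : x ∈ (trivializationAt (EuclideanSpace ℝ (Fin d))
    (TangentSpace (𝓡 d)) x).baseSet := by simp
  have h := Bundle.Trivialization.localFrameCoeff_apply_of_mem_baseSet (I := 𝓡 d)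
    (trivializationAt (EuclideanSpace ℝ (Fin d)) (TangentSpace (𝓡 d)) x)
    (EuclideanSpace.basisFun (Fin d) ℝ).toBasis hb (chartFrame x μ) ν
  rw [chartCoeff, h, chartFrame, Bundle.Trivialization.localFrame_apply_of_mem_baseSet (hx := hb),
    Module.Basis.repr_self, Finsupp.single_apply]

theorem extChartAt_target_eventually {d : ℕ} {M : Type*} [TopologicalSpace M]
    [ChartedSpace (EuclideanSpace ℝ (Fin d)) M] (x : M) :
    ∀ᶠ z in 𝓝 (extChartAt (𝓡 d) x x), z ∈ (extChartAt (𝓡 d) x).target :=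
  extChartAt_target_mem_nhds x

/-- The contravariant components `X^μ` of a vector field in the chart around `c`. -/
noncomputable def upperComp (X : SmoothVectorField d M) (c : M) (z : EuclideanSpace ℝ (Fin d))
    (μ : Fin d) : ℝ :=
  chartCoeff c μ ((extChartAt (𝓡 d) c).symm z) (X.val ((extChartAt (𝓡 d) c).symm z))

theorem sum_upperComp_smul_coordVec (X : SmoothVectorField d M) {c : M}
    {z : EuclideanSpace ℝ (Fin d)} (hz : z ∈ (extChartAt (𝓡 d) c).target) :
    ∑ μ, upperComp X c z μ • coordVec c μ z = X.val ((extChartAt (𝓡 d) c).symm z) := by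
  have hp : (extChartAt (𝓡 d) c).symm z ∈ (chartAt (EuclideanSpace ℝ (Fin d)) c).source := by
    simpa using (extChartAt (𝓡 d) c).map_target hz
  simp only [coordVec_eq_chartFrame hz]
  exact (eq_sum_chartCoeff_smul hp _).symm

theorem differentiableAt_upperComp (X : SmoothVectorField d M) (x : M) (μ : Fin d) :
    DifferentiableAt ℝ (fun z ↦ upperComp X x z μ) (extChartAt (𝓡 d) x x) :=
  differentiableAt_chart_of_contMDiffAt (contMDiffAt_chartCoeff X x μ)

theorem differentiableAt_apply_coordVec
    {B : ∀ p : M, TangentSpace (𝓡 d) p →L[ℝ] TangentSpace (𝓡 d) p →L[ℝ] ℝ}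
    (hB : ContMDiff (𝓡 d) ((𝓡 d).prod 𝓘(ℝ, EuclideanSpace ℝ (Fin d) →L[ℝ]
        EuclideanSpace ℝ (Fin d) →L[ℝ] ℝ)) ∞
      (fun x ↦ Bundle.TotalSpace.mk' (EuclideanSpace ℝ (Fin d) →L[ℝ]
        EuclideanSpace ℝ (Fin d) →L[ℝ] ℝ) x (B x))) (x : M) (μ ν : Fin d) :
    DifferentiableAt ℝ
      (fun z ↦ B ((extChartAt (𝓡 d) x).symm z) (coordVec x μ z) (coordVec x ν z))
      (extChartAt (𝓡 d) x x) := by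
  refine (differentiableAt_chart_of_contMDiffAt
    (contMDiffAt_apply_chartFrame hB x μ ν)).congr_of_eventuallyEq ?_
  filter_upwards [extChartAt_target_eventually x] with z hz
  rw [coordVec_eq_chartFrame hz, coordVec_eq_chartFrame hz]

theorem differentiableAt_metricComp (g : LorentzMetric d M) (x : M) (μ ν : Fin d) :
    DifferentiableAt ℝ (fun z ↦ metricComp g x z μ ν) (extChartAt (𝓡 d) x x) :=
  differentiableAt_apply_coordVec g.contMDiff x μ ν

theorem differentiableAt_formComp (F : TwoForm d M) (x : M) (μ ν : Fin d) :
    DifferentiableAt ℝ (fun z ↦ formComp F x z μ ν) (extChartAt (𝓡 d) x x) :=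
  differentiableAt_apply_coordVec F.contMDiff x μ ν

theorem metricComp_symm (g : LorentzMetric d M) (c : M) (z : EuclideanSpace ℝ (Fin d))
    (μ ν : Fin d) : metricComp g c z μ ν = metricComp g c z ν μ :=
  g.symm _ _ _

theorem TwoForm.antisymm (F : TwoForm d M) (x : M) (v w : TangentSpace (𝓡 d) x) :
    F.val x v w = - F.val x w v := by
  have h := F.alt x (v + w)
  simp only [map_add, add_apply, F.alt] at h
  linarith

theorem lowerComp_eq_sum (g : LorentzMetric d M) (X : SmoothVectorField d M) {c : M}
    {z : EuclideanSpace ℝ (Fin d)} (hz : z ∈ (extChartAt (𝓡 d) c).target) (μ : Fin d) :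
    lowerComp g X c z μ = ∑ ν, metricComp g c z μ ν * upperComp X c z ν := by
  rw [lowerComp, g.symm, ← sum_upperComp_smul_coordVec X hz, map_sum]
  refine Finset.sum_congr rfl fun ν _ ↦ ?_
  rw [map_smul, smul_eq_mul, mul_comm]; rfl

theorem differentiableAt_lowerComp (g : LorentzMetric d M) (X : SmoothVectorField d M) (x : M)
    (μ : Fin d) :
    DifferentiableAt ℝ (fun z ↦ lowerComp g X x z μ) (extChartAt (𝓡 d) x x) := by
  have h : DifferentiableAt ℝ (fun z ↦ ∑ ν, metricComp g x z μ ν * upperComp X x z ν)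
      (extChartAt (𝓡 d) x x) :=
    DifferentiableAt.fun_sum fun ν _ ↦
      (differentiableAt_metricComp g x μ ν).mul (differentiableAt_upperComp X x ν)
  refine h.congr_of_eventuallyEq ?_
  filter_upwards [extChartAt_target_eventually x] with z hz
  exact lowerComp_eq_sum g X hz μ

/-- The components `∇_a X^σ = ∂_a X^σ + Γ^σ_{aν} X^ν` of the covariant derivative of a vector
field. -/
noncomputable def covDerivUpper (g : LorentzMetric d M) (X : SmoothVectorField d M) (c : M)
    (y : EuclideanSpace ℝ (Fin d)) (a σ : Fin d) : ℝ :=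
  partialDeriv a (fun z ↦ upperComp X c z σ) y + ∑ ν, christoffel g c y σ a ν * upperComp X c y ν

theorem sum_metricComp_mul_covDerivUpper (g : LorentzMetric d M) (X : SmoothVectorField d M)
    (x : M) (hdet : IsUnit (metricComp g x (extChartAt (𝓡 d) x x)).det) (a μ : Fin d) :
    ∑ σ, metricComp g x (extChartAt (𝓡 d) x x) μ σ
        * covDerivUpper g X x (extChartAt (𝓡 d) x x) a σ
      = covDerivVec g X x (extChartAt (𝓡 d) x x) a μ := by
  refine lower_covDeriv (G := metricComp g x (extChartAt (𝓡 d) x x))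
    (Γ := christoffel g x (extChartAt (𝓡 d) x x))
    (u := upperComp X x (extChartAt (𝓡 d) x x))
    (l := lowerComp g X x (extChartAt (𝓡 d) x x))
    (du := fun a μ ↦ partialDeriv a (fun z ↦ upperComp X x z μ)
    (extChartAt (𝓡 d) x x))
    (dl := fun a μ ↦ partialDeriv a (fun z ↦ lowerComp g X x z μ)
    (extChartAt (𝓡 d) x x))
    (dG := fun a μ ν ↦ partialDeriv a (fun z ↦ metricComp g x z μ ν)
    (extChartAt (𝓡 d) x x)) (metricComp_symm g x _) (fun a μ ν ↦ ?_) (fun μ a ν ↦ ?_)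
    (lowerComp_eq_sum g X (mem_extChartAt_target x)) (fun a μ ↦ ?_) a μ
  · simp only [metricComp_symm g x _ μ ν]
  · exact sum_mul_christoffel (Matrix.mul_nonsing_inv _ hdet) (fun l ↦ _) μ
  · rw [← partialDeriv_sum_mul a (fun ν ↦ differentiableAt_metricComp g x μ ν)
      (fun ν ↦ differentiableAt_upperComp X x ν)]
    refine partialDeriv_congr a ?_
    filter_upwards [extChartAt_target_eventually x] with z hz
    exact lowerComp_eq_sum g X hz μ

theorem sum_upperComp_mul_covDerivVec (g : LorentzMetric d M) (X : SmoothVectorField d M)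
    (hX : ∀ p, g.val p (X.val p) (X.val p) = 0)
    (x : M) (hdet : IsUnit (metricComp g x (extChartAt (𝓡 d) x x)).det) (a : Fin d) :
    ∑ μ, upperComp X x (extChartAt (𝓡 d) x x) μ
      * covDerivVec g X x (extChartAt (𝓡 d) x x) a μ = 0 := by
  refine sum_mul_covDeriv_eq_zero (G := metricComp g x (extChartAt (𝓡 d) x x))
    (Γ := christoffel g x (extChartAt (𝓡 d) x x))
    (u := upperComp X x (extChartAt (𝓡 d) x x))
    (l := lowerComp g X x (extChartAt (𝓡 d) x x))
    (du := fun a μ ↦ partialDeriv a (fun z ↦ upperComp X x z μ)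
    (extChartAt (𝓡 d) x x))
    (dl := fun a μ ↦ partialDeriv a (fun z ↦ lowerComp g X x z μ)
    (extChartAt (𝓡 d) x x))
    (metricComp_symm g x _)
    (lowerComp_eq_sum g X (mem_extChartAt_target x)) a
    (sum_metricComp_mul_covDerivUpper g X x hdet a) ?_
  -- The goal becomes equality of the derivatives of `g(X, X)` and of the constant 0, so agreement
  -- near the centre of the chart suffices.
  rw [← partialDeriv_sum_mul a (fun ν ↦ differentiableAt_upperComp X x ν)
    (fun ν ↦ differentiableAt_lowerComp g X x ν), ← partialDeriv_const a 0]
  refine partialDeriv_congr a ?_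
  filter_upwards [extChartAt_target_eventually x] with z hz
  rw [← hX ((extChartAt (𝓡 d) x).symm z)]
  refine Eq.trans ?_ (congrArg (g.val _ (X.val _)) (sum_upperComp_smul_coordVec X hz))
  rw [map_sum]
  refine Finset.sum_congr rfl fun ν _ ↦ ?_
  rw [map_smul, smul_eq_mul]; rfl

theorem sum_covDerivForm_mul_upperComp (g : LorentzMetric d M) (F : TwoForm d M)
    (X : SmoothVectorField d M) (hFX : ∀ p v, F.val p v (X.val p) = 0) (x : M) (a μ : Fin d) :
    ∑ ν, covDerivForm g F x (extChartAt (𝓡 d) x x) a μ ν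
        * upperComp X x (extChartAt (𝓡 d) x x) ν
      = - ∑ σ, formComp F x (extChartAt (𝓡 d) x x) μ σ
        * covDerivUpper g X x (extChartAt (𝓡 d) x x) a σ := by
  have key : ∀ μ, ∀ z ∈ (extChartAt (𝓡 d) x).target,
      ∑ ν, formComp F x z μ ν * upperComp X x z ν = 0 := by
    intro μ z hz
    rw [← hFX ((extChartAt (𝓡 d) x).symm z) (coordVec x μ z), ← sum_upperComp_smul_coordVec X hz,
      map_sum]
    refine Finset.sum_congr rfl fun ν _ ↦ ?_
    rw [map_smul, smul_eq_mul, mul_comm]; rfl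
  refine sum_covDerivForm_mul (Γ := christoffel g x (extChartAt (𝓡 d) x x))
    (u := upperComp X x (extChartAt (𝓡 d) x x))
    (du := fun a μ ↦ partialDeriv a (fun z ↦ upperComp X x z μ)
    (extChartAt (𝓡 d) x x))
    (f := formComp F x (extChartAt (𝓡 d) x x))
    (df := fun a μ ν ↦ partialDeriv a (fun z ↦ formComp F x z μ ν)
    (extChartAt (𝓡 d) x x)) (fun μ ↦ key μ _ (mem_extChartAt_target x)) a μ ?_
  rw [← partialDeriv_sum_mul a (fun ν ↦ differentiableAt_formComp F x μ ν)
    (fun ν ↦ differentiableAt_upperComp X x ν), ← partialDeriv_const a 0]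
  refine partialDeriv_congr a ?_
  filter_upwards [extChartAt_target_eventually x] with z hz
  exact key μ z hz

theorem covDeriv_form_wedge (g : LorentzMetric d M) (F : TwoForm d M) (X : SmoothVectorField d M)
    (hFX : ∀ p u v w, F.val p u v * g.val p (X.val p) w + F.val p v w * g.val p (X.val p) u
      + F.val p w u * g.val p (X.val p) v = 0) (x : M) (a μ ν b : Fin d) :
    (covDerivForm g F x (extChartAt (𝓡 d) x x) a μ ν * lowerComp g X x (extChartAt (𝓡 d) x x) b
        + formComp F x (extChartAt (𝓡 d) x x) μ ν
          * covDerivVec g X x (extChartAt (𝓡 d) x x) a b)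
      + (covDerivForm g F x (extChartAt (𝓡 d) x x) a ν b
          * lowerComp g X x (extChartAt (𝓡 d) x x) μ
        + formComp F x (extChartAt (𝓡 d) x x) ν b
          * covDerivVec g X x (extChartAt (𝓡 d) x x) a μ)
      + (covDerivForm g F x (extChartAt (𝓡 d) x x) a b μ
          * lowerComp g X x (extChartAt (𝓡 d) x x) ν
        + formComp F x (extChartAt (𝓡 d) x x) b μ
          * covDerivVec g X x (extChartAt (𝓡 d) x x) a ν) = 0 := by
  refine covDeriv_wedge (Γ := christoffel g x (extChartAt (𝓡 d) x x))
    (l := lowerComp g X x (extChartAt (𝓡 d) x x))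
    (f := formComp F x (extChartAt (𝓡 d) x x))
    (df := fun a μ ν ↦ partialDeriv a (fun z ↦ formComp F x z μ ν)
    (extChartAt (𝓡 d) x x))
    (dl := fun a μ ↦ partialDeriv a (fun z ↦ lowerComp g X x z μ)
    (extChartAt (𝓡 d) x x))
    (fun μ ν b ↦ hFX _ _ _ _) a μ ν b ?_
  have hf := differentiableAt_formComp F x
  have hl := differentiableAt_lowerComp g X x
  rw [← partialDeriv_mul a (hf μ ν) (hl b), ← partialDeriv_mul a (hf ν b) (hl μ),
    ← partialDeriv_mul a (hf b μ) (hl ν),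
    ← partialDeriv_add a (.fun_mul (hf μ ν) (hl b)) (.fun_mul (hf ν b) (hl μ)),
    ← partialDeriv_add a (.fun_add (.fun_mul (hf μ ν) (hl b)) (.fun_mul (hf ν b) (hl μ)))
      (.fun_mul (hf b μ) (hl ν)), ← partialDeriv_const a 0]
  -- The wedge identity holds for arbitrary tangent vectors, so no restriction to the chart target
  -- is needed.
  exact partialDeriv_congr a (Eventually.of_forall fun z ↦ hFX _ _ _ _)

theorem covDerivForm_antisymm (g : LorentzMetric d M) (F : TwoForm d M) (x : M) (a μ ν : Fin d) :
    covDerivForm g F x (extChartAt (𝓡 d) x x) a μ ν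
      = - covDerivForm g F x (extChartAt (𝓡 d) x x) a ν μ := by
  have h : ∀ z μ ν, formComp F x z μ ν = - formComp F x z ν μ := fun z μ ν ↦ F.antisymm _ _ _
  have h' : partialDeriv a (fun z ↦ formComp F x z μ ν) (extChartAt (𝓡 d) x x)
      = - partialDeriv a (fun z ↦ formComp F x z ν μ) (extChartAt (𝓡 d) x x) := by
    simp only [h _ μ ν, partialDeriv]
    simp
  rw [covDerivForm, covDerivForm, h']
  simp only [h _ μ, h _ _ ν, mul_neg, Finset.sum_neg_distrib]
  ring

/-! ### Components at the centre of the chart -/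

theorem upperComp_self (X : SmoothVectorField d M) (x : M) (μ : Fin d) :
    upperComp X x (extChartAt (𝓡 d) x x) μ = vecComp x (X.val x) μ := by
  rw [vecComp_eq_chartCoeff]
  exact congrArg (fun p ↦ chartCoeff x μ p (X.val p)) (extChartAt_to_inv (I := 𝓡 d) x)

theorem apply_coordVec_self
    (B : ∀ p : M, TangentSpace (𝓡 d) p →L[ℝ] TangentSpace (𝓡 d) p →L[ℝ] ℝ) (x : M)
    (μ ν : Fin d) :
    B ((extChartAt (𝓡 d) x).symm (extChartAt (𝓡 d) x x)) (coordVec x μ (extChartAt (𝓡 d) x x))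
        (coordVec x ν (extChartAt (𝓡 d) x x))
      = B x (chartFrame x μ x) (chartFrame x ν x) := by
  rw [coordVec_eq_chartFrame (mem_extChartAt_target x),
    coordVec_eq_chartFrame (mem_extChartAt_target x)]
  exact congrArg (fun p ↦ B p (chartFrame x μ p) (chartFrame x ν p))
    (extChartAt_to_inv (I := 𝓡 d) x)

theorem metricComp_self (g : LorentzMetric d M) (x : M) (μ ν : Fin d) :
    metricComp g x (extChartAt (𝓡 d) x x) μ ν
      = g.val x (chartFrame x μ x) (chartFrame x ν x) :=
  apply_coordVec_self g.val x μ ν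

theorem formComp_self (F : TwoForm d M) (x : M) (μ ν : Fin d) :
    formComp F x (extChartAt (𝓡 d) x x) μ ν
      = F.val x (chartFrame x μ x) (chartFrame x ν x) :=
  apply_coordVec_self F.val x μ ν

theorem sum_vecComp_smul_chartFrame (x : M) (v : TangentSpace (𝓡 d) x) :
    ∑ μ, vecComp x v μ • chartFrame x μ x = v := by
  simp only [vecComp_eq_chartCoeff]
  exact (eq_sum_chartCoeff_smul (mem_chart_source _ x) v).symm

theorem lowerComp_self (g : LorentzMetric d M) (X : SmoothVectorField d M) (x : M) (μ : Fin d) :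
    lowerComp g X x (extChartAt (𝓡 d) x x) μ = g.val x (X.val x) (chartFrame x μ x) := by
  rw [lowerComp, coordVec_eq_chartFrame (mem_extChartAt_target x)]
  exact congrArg (fun p ↦ g.val p (X.val p) (chartFrame x μ p))
    (extChartAt_to_inv (I := 𝓡 d) x)

theorem sum_vecComp_mul_apply (x : M) (φ : TangentSpace (𝓡 d) x →L[ℝ] ℝ)
    (v : TangentSpace (𝓡 d) x) : ∑ μ, vecComp x v μ * φ (chartFrame x μ x) = φ v := by
  conv_rhs => rw [← sum_vecComp_smul_chartFrame x v]
  simp [map_sum]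

theorem sum_vecComp_mul_apply_left (x : M)
    (B : TangentSpace (𝓡 d) x →L[ℝ] TangentSpace (𝓡 d) x →L[ℝ] ℝ) (v w : TangentSpace (𝓡 d) x) :
    ∑ μ, vecComp x v μ * B (chartFrame x μ x) w = B v w := by
  conv_rhs => rw [← sum_vecComp_smul_chartFrame x v]
  simp [map_sum]

theorem vecComp_chartFrame (x : M) (μ ν : Fin d) :
    vecComp x (chartFrame x μ x) ν = if μ = ν then 1 else 0 := by
  rw [vecComp_eq_chartCoeff, chartCoeff_chartFrame]

end ChartComponents
-- Null frames: expansion of vectors and the inverse metric.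
namespace NullFrame

variable {d : ℕ} {M : Type*} [TopologicalSpace M]
  [ChartedSpace (EuclideanSpace ℝ (Fin d)) M] [IsManifold (𝓡 d) ∞ M]
  {g : LorentzMetric d M} {x : M} {l : TangentSpace (𝓡 d) x}

theorem expand (hd : 2 ≤ d) (e : NullFrame g x l) (v : TangentSpace (𝓡 d) x) :
    g.val x e.n v • l + g.val x l v • e.n + ∑ i, g.val x (e.m i) v • e.m i = v := by
  -- `NullFrame` records only scalar products. Taking products with the frame is onto, hence
  -- injective since `1 + 1 + (d - 2) = d`; both sides of the expansion have the same products.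
  let φ : TangentSpace (𝓡 d) x →ₗ[ℝ] ℝ × ℝ × (Fin (d - 2) → ℝ) :=
    (g.val x e.n).toLinearMap.prod
      ((g.val x l).toLinearMap.prod (LinearMap.pi fun i ↦ (g.val x (e.m i)).toLinearMap))
  have hφ : ∀ w, φ w = (g.val x e.n w, g.val x l w, fun i ↦ g.val x (e.m i) w) := fun _ ↦ rfl
  have hinv : ∀ a b c, φ (a • l + b • e.n + ∑ i, c i • e.m i) = (a, b, c) := by
    intro a b c
    simp [hφ, e.l_l, e.n_n, e.l_n, e.l_m, e.n_m, e.m_m, g.symm x e.n l, g.symm x (e.m _) l,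
      g.symm x (e.m _) e.n]
  have : FiniteDimensional ℝ (TangentSpace (𝓡 d) x) :=
    inferInstanceAs (FiniteDimensional ℝ (EuclideanSpace ℝ (Fin d)))
  have hrank : Module.finrank ℝ (TangentSpace (𝓡 d) x)
      = Module.finrank ℝ (ℝ × ℝ × (Fin (d - 2) → ℝ)) := by
    have : Module.finrank ℝ (TangentSpace (𝓡 d) x) = d :=
      (finrank_euclideanSpace_fin (𝕜 := ℝ) (n := d))
    simp [this]; omega
  have hinj : Function.Injective φ :=
    (LinearMap.injective_iff_surjective_of_finrank_eq_finrank hrank).2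
      fun ⟨a, b, c⟩ ↦ ⟨_, hinv a b c⟩
  exact hinj ((hinv _ _ _).trans (hφ v).symm)

theorem apply_expand (hd : 2 ≤ d) (e : NullFrame g x l) (φ : TangentSpace (𝓡 d) x →L[ℝ] ℝ)
    (v : TangentSpace (𝓡 d) x) :
    φ v = g.val x e.n v * φ l + g.val x l v * φ e.n + ∑ i, g.val x (e.m i) v * φ (e.m i) := by
  conv_lhs => rw [← e.expand hd v]
  simp [map_sum]

/-- The inverse metric in terms of the components of a null frame. -/
theorem metricComp_mul_inverse (hd : 2 ≤ d) (e : NullFrame g x l) :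
    metricComp g x (extChartAt (𝓡 d) x x) * (Matrix.of fun μ ν ↦ vecComp x l μ * vecComp x e.n ν
      + vecComp x e.n μ * vecComp x l ν + ∑ i, vecComp x (e.m i) μ * vecComp x (e.m i) ν) = 1 := by
  ext μ ν
  have h := congrArg (fun v ↦ chartCoeff x ν x v) (e.expand hd (chartFrame x μ x))
  simp only [map_add, map_sum, map_smul, smul_eq_mul, ← vecComp_eq_chartCoeff,
    vecComp_chartFrame] at h
  have hG : ∀ v, ∑ σ, g.val x (chartFrame x μ x) (chartFrame x σ x) * vecComp x v σ
      = g.val x v (chartFrame x μ x) := by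
    intro v
    rw [g.symm x v, ← sum_vecComp_mul_apply x _ v]
    exact Finset.sum_congr rfl fun _ _ ↦ mul_comm _ _
  rw [Matrix.one_apply, ← h, Matrix.mul_apply, ← hG, ← hG]
  simp only [Matrix.of_apply, metricComp_self, mul_add, Finset.sum_add_distrib, ← hG,
    Finset.sum_mul, Finset.mul_sum, mul_assoc]
  rw [add_comm (∑ σ, _ * (vecComp x l σ * _)), Finset.sum_comm]

/-- Guarantees that `⁻¹` in the Christoffel symbols is a true inverse rather than the default value
0 of a singular matrix. -/
theorem isUnit_det_metricComp (hd : 2 ≤ d) (e : NullFrame g x l) :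
    IsUnit (metricComp g x (extChartAt (𝓡 d) x x)).det :=
  Matrix.isUnit_det_of_right_inverse (e.metricComp_mul_inverse hd)

theorem inv_metricComp_apply (hd : 2 ≤ d) (e : NullFrame g x l) (μ ν : Fin d) :
    (metricComp g x (extChartAt (𝓡 d) x x))⁻¹ μ ν = vecComp x l μ * vecComp x e.n ν
      + vecComp x e.n μ * vecComp x l ν + ∑ i, vecComp x (e.m i) μ * vecComp x (e.m i) ν := by
  rw [Matrix.inv_eq_right_inv (e.metricComp_mul_inverse hd)]
  rfl

end NullFrame

/-! ### Frame-free forms of the alignment condition. -/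

section Aligned

variable {d : ℕ} {M : Type*} [TopologicalSpace M]
  [ChartedSpace (EuclideanSpace ℝ (Fin d)) M] [IsManifold (𝓡 d) ∞ M]
  {g : LorentzMetric d M} {F : TwoForm d M} {ℓ : SmoothVectorField d M}

theorem MultiplyAligned.apply_eq_zero (hd : 2 ≤ d) (hal : MultiplyAligned g F ℓ) (x : M)
    (v : TangentSpace (𝓡 d) x) : F.val x v (ℓ.val x) = 0 := by
  obtain ⟨e, h1, h2, -⟩ := hal x
  rw [F.antisymm, e.apply_expand hd (F.val x (ℓ.val x)) v]
  simp [h1, h2, F.alt]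

/-- The witness is `F(n, ·)` for the frame supplied by alignment. No smoothness of it in `x` is
claimed; only consequences free of `φ` get differentiated. -/
theorem MultiplyAligned.apply_eq (hd : 2 ≤ d) (hal : MultiplyAligned g F ℓ) (x : M) :
    ∃ φ : TangentSpace (𝓡 d) x →L[ℝ] ℝ, ∀ v w,
      F.val x v w = g.val x (ℓ.val x) v * φ w - g.val x (ℓ.val x) w * φ v := by
  obtain ⟨e, h1, h2, h3⟩ := hal x
  refine ⟨F.val x e.n, fun v w ↦ ?_⟩
  have hl := hal.apply_eq_zero hd x
  have hm : ∀ i, F.val x (e.m i) w = - (g.val x (ℓ.val x) w * F.val x e.n (e.m i)) := by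
    intro i
    rw [e.apply_expand hd (F.val x (e.m i)) w, hl, F.antisymm x (e.m i) e.n]
    simp [h3]
  have hn : F.val x e.n v = ∑ i, g.val x (e.m i) v * F.val x e.n (e.m i) := by
    rw [e.apply_expand hd (F.val x e.n) v, hl, F.alt]
    simp
  have hs : ∑ i, g.val x (e.m i) v * F.val x w (e.m i)
      = g.val x (ℓ.val x) w * F.val x e.n v := by
    rw [hn, Finset.mul_sum]
    refine Finset.sum_congr rfl fun i _ ↦ ?_
    rw [F.antisymm x w, hm]; ring
  rw [F.antisymm, e.apply_expand hd (F.val x w) v, hl, F.antisymm x w e.n, hs]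
  ring

theorem MultiplyAligned.wedge_eq_zero (hd : 2 ≤ d) (hal : MultiplyAligned g F ℓ) (x : M)
    (u v w : TangentSpace (𝓡 d) x) :
    F.val x u v * g.val x (ℓ.val x) w + F.val x v w * g.val x (ℓ.val x) u
      + F.val x w u * g.val x (ℓ.val x) v = 0 := by
  obtain ⟨φ, h⟩ := hal.apply_eq hd x
  simp only [h]; ring

end Aligned
-- Algebraic consequences of the Maxwell equations in a null frame.
section FrameAlgebra

variable {V : Type*} {k : ℕ}

/-- The frame components of the Maxwell equations for a 2-form with only boost weight `-1`
components. -/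
theorem maxwell_frame_equations {D : V → V → V → ℝ} {f L g : V → V → ℝ} {l n : V}
    {m : Fin k → V} (hl_n : g l n = 1) (hl_m : ∀ i, g l (m i) = 0)
    (hf : ∀ a b, f a b = - f b a)
    (hf_m : ∀ i j, f (m i) (m j) = 0)
    (hD : ∀ a b c, D a b c = - D a c b)
    (hcyc : ∀ a b c, D a b c + D b c a + D c a b = 0)
    (hdiv : ∀ c, D l n c + D n l c + ∑ i, D (m i) (m i) c = 0)
    (hDl : ∀ a b, D a b l = - ∑ i, f b (m i) * L (m i) a)
    (hwedge : ∀ a b c e, (D a b c * g l e + f b c * L e a) + (D a c e * g l b + f c e * L b a)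
      + (D a e b * g l c + f e b * L c a) = 0) :
    (∑ i, f n (m i) * L (m i) l = 0) ∧
    (∀ i j, f n (m i) * L (m j) l = f n (m j) * L (m i) l) ∧
    (∀ j, ∑ i, (L (m i) (m j) + L (m j) (m i)) * f n (m i)
      = (∑ i, L (m i) (m i)) * f n (m j)) ∧
    (∀ i j q, f n (m i) * (L (m j) (m q) - L (m q) (m j))
      + f n (m j) * (L (m q) (m i) - L (m i) (m q))
      + f n (m q) * (L (m i) (m j) - L (m j) (m i)) = 0) := by
  have hml : ∀ a i, D a (m i) l = 0 := by simp [hDl, hf_m]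
  have hll : ∀ a, D a l l = 0 := fun a ↦ by linarith [hD a l l]
  -- Among `n, m i, m j` only `n` has a nonzero product with `l`, so a single derivative of `f`
  -- survives.
  have hmm : ∀ a i j, D a (m i) (m j) = f n (m j) * L (m i) a - f n (m i) * L (m j) a := by
    intro a i j
    have h := hwedge a n (m i) (m j)
    rw [hl_n, hl_m, hl_m, hf_m, hf (m j) n] at h
    linarith
  refine ⟨?_, fun i j ↦ ?_, fun j ↦ ?_, fun i j q ↦ ?_⟩
  · have h := hdiv l
    simp only [hml, hll, Finset.sum_const_zero, hDl l n] at h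
    linarith
  · have h := hcyc l (m i) (m j)
    rw [hml, hD _ l, hml, hmm] at h
    linarith
  · have h := hdiv (m j)
    -- `D l n (m j)` is not determined by `f` and `L`; it occurs in both `h` and `h1` and is
    -- eliminated between them.
    have h1 := hcyc l n (m j)
    rw [hD n (m j) l, hD _ l n] at h1
    rw [hD n l, hml] at h
    rw [hD n l, hml, hDl (m j) n] at h1
    simp only [hmm, Finset.sum_sub_distrib] at h
    have h2 : ∑ i, (L (m i) (m j) + L (m j) (m i)) * f n (m i)
        = ∑ i, f n (m i) * L (m i) (m j) + ∑ i, f n (m i) * L (m j) (m i) := by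
      rw [← Finset.sum_add_distrib]
      exact Finset.sum_congr rfl fun i _ ↦ by ring
    rw [h2, Finset.sum_mul]
    simp only [mul_comm (L _ _)]
    linarith
  · have h := hcyc (m i) (m j) (m q)
    simp only [hmm] at h
    linarith

/-- A vector both parallel and orthogonal to a nonzero `φ` vanishes: `|φ|² κ_i = φ_i (φ · κ)`. -/
theorem eq_zero_of_sum_mul_eq_zero_of_mul_comm {φ κ : Fin k → ℝ} (hφ : φ ≠ 0)
    (h : ∑ i, φ i * κ i = 0) (hc : ∀ i j, φ i * κ j = φ j * κ i) (i : Fin k) : κ i = 0 := by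
  have hpos : ∑ j, φ j * φ j ≠ 0 := fun h0 ↦ hφ (dotProduct_self_eq_zero.1 h0)
  have : (∑ j, φ j * φ j) * κ i = φ i * ∑ j, φ j * κ j := by
    rw [Finset.sum_mul, Finset.mul_sum]
    refine Finset.sum_congr rfl fun j _ ↦ ?_
    rw [mul_assoc, hc j i]; ring
  rw [h, mul_zero] at this
  exact (mul_eq_zero.1 this).resolve_left hpos

theorem exists_antisymPart_eq_vecMulVec {φ : Fin k → ℝ} (hφ : φ ≠ 0)
    (A : Matrix (Fin k) (Fin k) ℝ)
    (h : ∀ i j q, φ i * (A j q - A q j) + φ j * (A q i - A i q) + φ q * (A i j - A j i) = 0) :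
    ∃ w, antisymPart A = antisymPart (Matrix.vecMulVec φ w) := by
  have hpos : ∑ j, φ j * φ j ≠ 0 := fun h0 ↦ hφ (dotProduct_self_eq_zero.1 h0)
  -- Contracting the hypothesis with `φ i` and dividing by `|φ|²` produces this `w`.
  refine ⟨fun j ↦ (∑ i, φ i * (A i j - A j i)) / ∑ j, φ j * φ j, ?_⟩
  ext j q
  have hs : (∑ i, φ i * φ i) * (A j q - A q j)
      = φ j * ∑ i, φ i * (A i q - A q i) - φ q * ∑ i, φ i * (A i j - A j i) := by
    rw [Finset.sum_mul, Finset.mul_sum, Finset.mul_sum, ← Finset.sum_sub_distrib]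
    exact Finset.sum_congr rfl fun i _ ↦ by linear_combination φ i * h i j q
  simp only [antisymPart, Matrix.smul_apply, Matrix.sub_apply, Matrix.transpose_apply,
    Matrix.vecMulVec_apply, smul_eq_mul]
  have hA : A j q - A q j = φ j * ((∑ i, φ i * (A i q - A q i)) / ∑ i, φ i * φ i)
      - φ q * ((∑ i, φ i * (A i j - A j i)) / ∑ i, φ i * φ i) := by
    rw [mul_div_assoc', mul_div_assoc', ← sub_div, eq_div_iff hpos]
    linarith
  rw [hA]

theorem hasEigenvector_symPart {φ : Fin k → ℝ} (hφ : φ ≠ 0) {A : Matrix (Fin k) (Fin k) ℝ}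
    (h : ∀ j, ∑ i, (A i j + A j i) * φ i = A.trace * φ j) :
    Module.End.HasEigenvector (Matrix.toLin' (symPart A)) (A.trace / 2) φ := by
  refine Module.End.hasEigenvector_iff.2 ⟨Module.End.mem_eigenspace_iff.2 ?_, hφ⟩
  ext j
  rw [Matrix.toLin'_apply, symPart, Matrix.smul_mulVec, Pi.smul_apply]
  simp only [Pi.smul_apply, smul_eq_mul, Matrix.mulVec, dotProduct, Matrix.add_apply, Matrix.transpose_apply]
  have := h j
  simp only [add_comm (A _ j)] at this
  rw [this]; ring

end FrameAlgebra

/-! ### Contraction of the component identity with three vectors. -/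

section Contraction

variable {ι : Type*} [Fintype ι]

theorem contract_wedge {f D : ι → ι → ℝ} {l L : ι → ℝ}
    (h : ∀ μ ν b, (D μ ν * l b + f μ ν * L b) + (D ν b * l μ + f ν b * L μ)
      + (D b μ * l ν + f b μ * L ν) = 0) (u v w : ι → ℝ) :
    ((∑ i, ∑ j, u i * v j * D i j) * ∑ k, w k * l k
        + (∑ i, ∑ j, u i * v j * f i j) * ∑ k, w k * L k)
      + ((∑ j, ∑ k, v j * w k * D j k) * ∑ i, u i * l i
        + (∑ j, ∑ k, v j * w k * f j k) * ∑ i, u i * L i)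
      + ((∑ k, ∑ i, w k * u i * D k i) * ∑ j, v j * l j
        + (∑ k, ∑ i, w k * u i * f k i) * ∑ j, v j * L j) = 0 := by
  have key : ∀ (u v w : ι → ℝ) (A : ι → ι → ℝ) (p : ι → ℝ),
      (∑ i, ∑ j, u i * v j * A i j) * ∑ k, w k * p k
        = ∑ i, ∑ j, ∑ k, u i * v j * w k * (A i j * p k) := by
    intro u v w A p
    simp only [Finset.sum_mul]
    simp only [Finset.mul_sum]
    exact Finset.sum_congr rfl fun i _ ↦ Finset.sum_congr rfl fun j _ ↦
      Finset.sum_congr rfl fun k _ ↦ by ring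
  have key2 : ∀ (A : ι → ι → ℝ) (p : ι → ℝ), (∑ j, ∑ k, v j * w k * A j k) * ∑ i, u i * p i
      = ∑ i, ∑ j, ∑ k, u i * v j * w k * (A j k * p i) := by
    intro A p
    rw [key, Finset.sum_comm_cycle]
    exact Finset.sum_congr rfl fun i _ ↦ Finset.sum_congr rfl fun j _ ↦
      Finset.sum_congr rfl fun k _ ↦ by ring
  have key3 : ∀ (A : ι → ι → ℝ) (p : ι → ℝ), (∑ k, ∑ i, w k * u i * A k i) * ∑ j, v j * p j
      = ∑ i, ∑ j, ∑ k, u i * v j * w k * (A k i * p j) := by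
    intro A p
    rw [key, ← Finset.sum_comm_cycle]
    exact Finset.sum_congr rfl fun i _ ↦ Finset.sum_congr rfl fun j _ ↦
      Finset.sum_congr rfl fun k _ ↦ by ring
  rw [key, key, key2, key2, key3, key3]
  simp only [← Finset.sum_add_distrib]
  refine Finset.sum_eq_zero fun i _ ↦ Finset.sum_eq_zero fun j _ ↦ Finset.sum_eq_zero fun k _ ↦ ?_
  linear_combination u i * v j * w k * h i j k

end Contraction

/-! ### The tensors `∇F` and `∇X` at a point, evaluated on tangent vectors. -/

section PointwiseTensors

variable {d : ℕ} {M : Type*} [TopologicalSpace M]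
  [ChartedSpace (EuclideanSpace ℝ (Fin d)) M] [IsManifold (𝓡 d) ∞ M]

/-- The trilinear form `(∇_a F)(b, c)` on the tangent space at `x`. -/
noncomputable def nablaFormAt (g : LorentzMetric d M) (F : TwoForm d M) (x : M)
    (a b c : TangentSpace (𝓡 d) x) : ℝ :=
  ∑ i, ∑ j, ∑ k, vecComp x a i * vecComp x b j * vecComp x c k
    * covDerivForm g F x (extChartAt (𝓡 d) x x) i j k

variable (g : LorentzMetric d M) (F : TwoForm d M) (X : SmoothVectorField d M) (x : M)
  (a b c w : TangentSpace (𝓡 d) x)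

theorem nablaFormAt_antisymm : nablaFormAt g F x a b c = - nablaFormAt g F x a c b := by
  unfold nablaFormAt
  rw [← Finset.sum_neg_distrib]
  refine Finset.sum_congr rfl fun i _ ↦ ?_
  rw [Finset.sum_comm, ← Finset.sum_neg_distrib]
  refine Finset.sum_congr rfl fun j _ ↦ ?_
  rw [← Finset.sum_neg_distrib]
  refine Finset.sum_congr rfl fun k _ ↦ ?_
  rw [covDerivForm_antisymm]; ring

theorem nablaFormAt_cyclic {F : TwoForm d M} (hF : IsMaxwell g F) :
    nablaFormAt g F x a b c + nablaFormAt g F x b c a + nablaFormAt g F x c a b = 0 := by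
  have h2 : nablaFormAt g F x b c a = ∑ i, ∑ j, ∑ k, vecComp x a i * vecComp x b j * vecComp x c k
      * covDerivForm g F x (extChartAt (𝓡 d) x x) j k i := by
    unfold nablaFormAt
    rw [Finset.sum_comm_cycle]
    exact Finset.sum_congr rfl fun i _ ↦ Finset.sum_congr rfl fun j _ ↦
      Finset.sum_congr rfl fun k _ ↦ by ring
  have h3 : nablaFormAt g F x c a b = ∑ i, ∑ j, ∑ k, vecComp x a i * vecComp x b j * vecComp x c k
      * covDerivForm g F x (extChartAt (𝓡 d) x x) k i j := by
    unfold nablaFormAt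
    rw [← Finset.sum_comm_cycle]
    exact Finset.sum_congr rfl fun i _ ↦ Finset.sum_congr rfl fun j _ ↦
      Finset.sum_congr rfl fun k _ ↦ by ring
  rw [h2, h3, nablaFormAt]
  simp only [← Finset.sum_add_distrib]
  refine Finset.sum_eq_zero fun i _ ↦ Finset.sum_eq_zero fun j _ ↦ Finset.sum_eq_zero fun k _ ↦ ?_
  rw [← mul_add, ← mul_add, (hF x).2, mul_zero]

theorem nablaFormAt_divergence (hd : 2 ≤ d) {F : TwoForm d M} {g : LorentzMetric d M}
    {l : TangentSpace (𝓡 d) x} (hF : IsMaxwell g F) (e : NullFrame g x l) :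
    nablaFormAt g F x l e.n c + nablaFormAt g F x e.n l c
      + ∑ i, nablaFormAt g F x (e.m i) (e.m i) c = 0 := by
  have h : ∑ k, vecComp x c k * ∑ i, ∑ j, (metricComp g x (extChartAt (𝓡 d) x x))⁻¹ i j *
      covDerivForm g F x (extChartAt (𝓡 d) x x) i j k = 0 :=
    Finset.sum_eq_zero fun k _ ↦ by rw [(hF x).1, mul_zero]
  have hD : ∀ a b, nablaFormAt g F x a b c = ∑ k, vecComp x c k * ∑ i, ∑ j,
      vecComp x a i * vecComp x b j * covDerivForm g F x (extChartAt (𝓡 d) x x) i j k := by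
    intro a b
    simp only [Finset.mul_sum]
    rw [← Finset.sum_comm_cycle, nablaFormAt]
    exact Finset.sum_congr rfl fun i _ ↦ Finset.sum_congr rfl fun j _ ↦
      Finset.sum_congr rfl fun k _ ↦ by ring
  have hm : ∑ q, nablaFormAt g F x (e.m q) (e.m q) c = ∑ k, vecComp x c k * ∑ i, ∑ j,
      (∑ q, vecComp x (e.m q) i * vecComp x (e.m q) j)
        * covDerivForm g F x (extChartAt (𝓡 d) x x) i j k := by
    simp only [hD, Finset.mul_sum, Finset.sum_mul]
    rw [Finset.sum_comm]
    refine Finset.sum_congr rfl fun k _ ↦ ?_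
    rw [Finset.sum_comm]
    refine Finset.sum_congr rfl fun i _ ↦ ?_
    rw [Finset.sum_comm]
  rw [← h, hm, hD, hD]
  simp only [e.inv_metricComp_apply hd, add_mul, mul_add, Finset.sum_add_distrib]

/-- The tangent vector `∇_a X` at `x`. -/
noncomputable def nablaVecAt : TangentSpace (𝓡 d) x :=
  ∑ i, ∑ σ, (vecComp x a i * covDerivUpper g X x (extChartAt (𝓡 d) x x) i σ) • chartFrame x σ x

/-- Stated for a general `B` because both the metric and `F` are applied to `∇_a X`. -/
theorem apply_nablaVecAt (B : TangentSpace (𝓡 d) x →L[ℝ] TangentSpace (𝓡 d) x →L[ℝ] ℝ) :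
    B b (nablaVecAt g X x a) = ∑ i, ∑ μ, vecComp x a i * vecComp x b μ
      * ∑ σ, B (chartFrame x μ x) (chartFrame x σ x)
        * covDerivUpper g X x (extChartAt (𝓡 d) x x) i σ := by
  have hb : ∀ v, B b v = ∑ μ, vecComp x b μ * B (chartFrame x μ x) v := fun v ↦
    (sum_vecComp_mul_apply_left x B b v).symm
  rw [nablaVecAt, map_sum]
  refine Finset.sum_congr rfl fun i _ ↦ ?_
  simp only [map_sum, map_smul, hb, smul_eq_mul, Finset.mul_sum]
  exact Finset.sum_congr rfl fun μ _ ↦ Finset.sum_congr rfl fun σ _ ↦ by ring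

theorem metric_nablaVecAt {g : LorentzMetric d M} {l : TangentSpace (𝓡 d) x} (hd : 2 ≤ d)
    (e : NullFrame g x l) : g.val x b (nablaVecAt g X x a) = nablaAt g X x b a := by
  rw [apply_nablaVecAt, nablaAt, Finset.sum_comm]
  simp only [← metricComp_self,
    sum_metricComp_mul_covDerivUpper g X x (e.isUnit_det_metricComp hd)]
  exact Finset.sum_congr rfl fun i _ ↦ Finset.sum_congr rfl fun j _ ↦ by ring

theorem nablaFormAt_apply_self {F : TwoForm d M} {X : SmoothVectorField d M}
    (hFX : ∀ p v, F.val p v (X.val p) = 0) :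
    nablaFormAt g F x a b (X.val x) = - F.val x b (nablaVecAt g X x a) := by
  rw [apply_nablaVecAt, nablaFormAt, ← Finset.sum_neg_distrib]
  refine Finset.sum_congr rfl fun i _ ↦ ?_
  rw [← Finset.sum_neg_distrib]
  refine Finset.sum_congr rfl fun j _ ↦ ?_
  have h := sum_covDerivForm_mul_upperComp g F X hFX x i j
  simp only [upperComp_self, formComp_self] at h
  rw [← mul_neg, ← h, Finset.mul_sum]
  exact Finset.sum_congr rfl fun k _ ↦ by ring

theorem nablaAt_self {X : SmoothVectorField d M} (hd : 2 ≤ d) (e : NullFrame g x (X.val x))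
    (hX : ∀ p, g.val p (X.val p) (X.val p) = 0) : nablaAt g X x (X.val x) a = 0 := by
  unfold nablaAt
  rw [Finset.sum_comm]
  refine Finset.sum_eq_zero fun ν _ ↦ ?_
  have h := sum_upperComp_mul_covDerivVec g X hX x (e.isUnit_det_metricComp hd) ν
  simp only [upperComp_self] at h
  rw [← mul_zero (vecComp x a ν), ← h, Finset.mul_sum]
  exact Finset.sum_congr rfl fun μ _ ↦ by ring

theorem nablaFormAt_apply_null {g : LorentzMetric d M} {F : TwoForm d M}
    {X : SmoothVectorField d M} (hd : 2 ≤ d)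
    (e : NullFrame g x (X.val x)) (hX : ∀ p, g.val p (X.val p) (X.val p) = 0)
    (hFX : ∀ p v, F.val p v (X.val p) = 0) :
    nablaFormAt g F x a b (X.val x) = - ∑ i, F.val x b (e.m i) * nablaAt g X x (e.m i) a := by
  rw [nablaFormAt_apply_self g x a b hFX, e.apply_expand hd (F.val x b), hFX]
  simp only [metric_nablaVecAt X x a _ hd e, nablaAt_self g x a hd e hX, zero_mul,
    zero_add, mul_comm (nablaAt _ _ _ _ _)]

theorem nablaFormAt_wedge (hFX : ∀ p u v w, F.val p u v * g.val p (X.val p) w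
      + F.val p v w * g.val p (X.val p) u + F.val p w u * g.val p (X.val p) v = 0) :
    (nablaFormAt g F x a b c * g.val x (X.val x) w + F.val x b c * nablaAt g X x w a)
      + (nablaFormAt g F x a c w * g.val x (X.val x) b + F.val x c w * nablaAt g X x b a)
      + (nablaFormAt g F x a w b * g.val x (X.val x) c + F.val x w b * nablaAt g X x c a) = 0 := by
  have hD : ∀ b c, nablaFormAt g F x a b c = ∑ j, ∑ k, vecComp x b j * vecComp x c k
      * ∑ i, vecComp x a i * covDerivForm g F x (extChartAt (𝓡 d) x x) i j k := by
    intro b c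
    simp only [Finset.mul_sum]
    rw [Finset.sum_comm_cycle, nablaFormAt]
    exact Finset.sum_congr rfl fun i _ ↦ Finset.sum_congr rfl fun j _ ↦
      Finset.sum_congr rfl fun k _ ↦ by ring
  have hf : ∀ b c, F.val x b c = ∑ j, ∑ k, vecComp x b j * vecComp x c k
      * formComp F x (extChartAt (𝓡 d) x x) j k := by
    intro b c
    rw [← sum_vecComp_mul_apply_left x (F.val x) b]
    refine Finset.sum_congr rfl fun j _ ↦ ?_
    rw [← sum_vecComp_mul_apply x _ c, Finset.mul_sum]
    exact Finset.sum_congr rfl fun k _ ↦ by rw [formComp_self, mul_assoc]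
  have hL : ∀ w, nablaAt g X x w a = ∑ k, vecComp x w k
      * ∑ i, vecComp x a i * covDerivVec g X x (extChartAt (𝓡 d) x x) i k := by
    intro w
    simp only [nablaAt, Finset.mul_sum, mul_assoc]
  have hl : ∀ w, g.val x (X.val x) w
      = ∑ k, vecComp x w k * lowerComp g X x (extChartAt (𝓡 d) x x) k := by
    intro w
    simp only [lowerComp_self, sum_vecComp_mul_apply]
  simp only [hD, hf, hL, hl]
  refine contract_wedge (fun μ ν q ↦ ?_) _ _ _
  simp only [Finset.sum_mul, Finset.mul_sum, ← Finset.sum_add_distrib]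
  refine Finset.sum_eq_zero fun i _ ↦ ?_
  linear_combination vecComp x a i * covDeriv_form_wedge g F X hFX x i μ ν q

end PointwiseTensors
end Spacetime

/-! ### Conclusion at a point where `F` does not vanish. -/

theorem mainTheorem4 (d : ℕ) (hd : 4 ≤ d) (M : Type*) [TopologicalSpace M]
    [ChartedSpace (EuclideanSpace ℝ (Fin d)) M] [IsManifold (𝓡 d) ∞ M]
    (g : LorentzMetric d M) (F : TwoForm d M) (ℓ : SmoothVectorField d M)
    (hℓ : IsNullField g ℓ) (hF : IsMaxwell g F) (hal : MultiplyAligned g F ℓ)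
    (x : M) (hx : F.val x ≠ 0) :
    GeodesicAt g ℓ x ∧
    ∀ e : NullFrame g x (ℓ.val x),
      (∀ i, kappa e i = 0) ∧
      Module.End.HasEigenvector (Matrix.toLin' (symPart (rho e))) ((rho e).trace / 2)
        (phiPrime F e) ∧
      ∃ w : Fin (d - 2) → ℝ,
        antisymPart (rho e) = antisymPart (Matrix.vecMulVec (phiPrime F e) w) := by
  have hd2 : 2 ≤ d := by omega
  have hnull : ∀ p, g.val p (ℓ.val p) (ℓ.val p) = 0 := fun p ↦ (hℓ p).2
  have hFℓ : ∀ p v, F.val p v (ℓ.val p) = 0 := fun p v ↦ hal.apply_eq_zero hd2 p v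
  obtain ⟨φ, hφ⟩ := hal.apply_eq hd2 x
  -- Alignment supplies one frame; the form `ℓ♭ ∧ φ` transfers the vanishing to every frame
  -- containing `ℓ`.
  have hmm : ∀ (e : NullFrame g x (ℓ.val x)) i j, F.val x (e.m i) (e.m j) = 0 := fun e i j ↦ by
    rw [hφ, e.l_m, e.l_m]; ring
  have hne : ∀ e : NullFrame g x (ℓ.val x), phiPrime F e ≠ 0 := by
    intro e h0
    have h0' : ∀ i, F.val x e.n (e.m i) = 0 := fun i ↦ congrFun h0 i
    refine hx (ContinuousLinearMap.ext fun v ↦ ContinuousLinearMap.ext fun w ↦ ?_)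
    have hn : ∀ v, F.val x e.n v = 0 := fun v ↦ by
      rw [e.apply_expand hd2 (F.val x e.n) v, hFℓ, F.alt]; simp [h0']
    have hm : ∀ i v, F.val x (e.m i) v = 0 := fun i v ↦ by
      rw [e.apply_expand hd2 (F.val x (e.m i)) v, hFℓ, F.antisymm x _ e.n, hn]; simp [hmm]
    rw [F.antisymm, e.apply_expand hd2 (F.val x w) v, hFℓ, F.antisymm x _ e.n, hn]
    simp [F.antisymm x w (e.m _), hm]
  have key := fun e : NullFrame g x (ℓ.val x) ↦
    maxwell_frame_equations (D := nablaFormAt g F x) (f := fun v w ↦ F.val x v w)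
      (L := nablaAt g ℓ x) (g := fun v w ↦ g.val x v w) (m := e.m) e.l_n e.l_m
      (F.antisymm x) (hmm e) (nablaFormAt_antisymm g F x)
      (fun a b c ↦ nablaFormAt_cyclic g x a b c hF)
      (fun c ↦ nablaFormAt_divergence x c hd2 hF e)
      (fun a b ↦ nablaFormAt_apply_null x a b hd2 e hnull hFℓ)
      (fun a b c w ↦ nablaFormAt_wedge g F ℓ x a b c w (hal.wedge_eq_zero hd2))
  have hκ : ∀ (e : NullFrame g x (ℓ.val x)) i, kappa e i = 0 := fun e ↦
    eq_zero_of_sum_mul_eq_zero_of_mul_comm (hne e) (key e).1 (key e).2.1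
  refine ⟨?_, fun e ↦ ⟨hκ e, hasEigenvector_symPart (hne e) (key e).2.2.1,
    exists_antisymPart_eq_vecMulVec (hne e) _ (key e).2.2.2⟩⟩
  obtain ⟨e, -⟩ := hal x
  have hκ' : ∀ i, nablaAt g ℓ x (e.m i) (ℓ.val x) = 0 := hκ e
  -- In the frame expansion of `∇_ℓ ℓ` the `n` component vanishes by nullity and the `m_i`
  -- components are `κ_i = 0`; the remaining `ℓ` component is `g(n, ∇_ℓ ℓ)`.
  refine ⟨nablaAt g ℓ x e.n (ℓ.val x), fun w ↦ ?_⟩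
  rw [← metric_nablaVecAt ℓ x (ℓ.val x) w hd2 e, e.apply_expand hd2 (g.val x w),
    metric_nablaVecAt ℓ x _ _ hd2 e, metric_nablaVecAt ℓ x _ _ hd2 e,
    nablaAt_self g x _ hd2 e hnull]
  simp [metric_nablaVecAt ℓ x _ _ hd2 e, hκ']
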